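/- For an $M\times N$ real matrix $A=(a_{i,j})$ let $\mathrm{Per}(A)$ be the sum of $\prod_{i=1}^{M}a_{i,\alpha(i)}$ over all injections $\alpha:\{1,\dots,M\}\to\{1,\dots,N\}$ if $M\le N$, and the sum of $\prod_{j=1}^{N}a_{\beta(j),j}$ over all injections $\beta:\{1,\dots,N\}\to\{1,\dots,M\}$ if $M>N$; an empty product is $1$. The extended permanent of $A$ is $\underline{\mathrm{Per}}(A)=\mathrm{Per}([I_M\ A])$. Let $\gamma>0$ and let $\Omega=(\omega_{j,i})$ be a nonzero $N_r\times N_t$ matrix with nonnegative entries. For $\lambda\in\mathbb{R}^{N_t}$ put $E(\lambda)=\underline{\mathrm{Per}}(\gamma\,\Omega\,\mathrm{diag}(\lambda))$ and $\tilde C_u(\lambda)=\log E(\lambda)$. For $1\le i\le N_t$ let $\lambda_{(i)}$ be $\lambda$ with its $i$-th entry deleted, let $\Omega_{(i)}$ be $\Omega$ with its $i$-th column deleted, let $\Omega_{(i)}^{(j)}$ be $\Omega$ with its $j$-th row and $i$-th column deleted, and put $$p(\lambda_{(i)})=\underline{\mathrm{Per}}\bigl(\gamma\,\Omega_{(i)}\,\mathrm{diag}(\lambda_{(i)})\bigr),\qquad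 q(\lambda_{(i)})=\sum_{j=1}^{N_r}\gamma\,\omega_{j,i}\,\underline{\mathrm{Per}}\bigl(\gamma\,\Omega_{(i)}^{(j)}\,\mathrm{diag}(\lambda_{(i)})\bigr).$$ Then: 1. $\tilde C_u$ is concave on $\{\lambda\in\mathbb{R}^{N_t}:\lambda\ge 0\}$. 2. $E(\lambda)=p(\lambda_{(i)})+\lambda_i\,q(\lambda_{(i)})$ for all $\lambda\in\mathbb{R}^{N_t}$ and all $1\le i\le N_t$. 3. A vector $\lambda\in\mathbb{R}^{N_t}$ maximizes $\tilde C_u$ over $\{\lambda\ge 0,\ \sum_{i=1}^{N_t}\lambda_i=N_t\}$ (and belongs to this set) if and only if there is a real number $\tilde\nu$ such that $$\lambda_i=\Bigl(\tilde\nu-\frac{p(\lambda_{(i)})}{q(\lambda_{(i)})}\Bigr)^{+}\quad\text{for } 1\le i\le N_t,\qquad \sum_{i=1}^{N_t}\lambda_i=N_t,$$ where $(a)^{+}=\max\{0,a\}$, and where the $i$-th condition is read as $\lambda_i=0$ (that is, $p/q=+\infty$) if $q(\lambda_{(i)})=0$. -/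

import Mathlib

noncomputable section

namespace PowerAllocation

variable {m n : Type*} [Fintype m] [Fintype n] [DecidableEq m] [DecidableEq n]

/-- The permanent of a rectangular matrix: the sum over all injections of the smaller index set
into the larger one. -/
def per (A : Matrix m n ℝ) : ℝ :=
  if Fintype.card m ≤ Fintype.card n then
    ∑ α : m ↪ n, ∏ i, A i (α i)
  else
    ∑ β : n ↪ m, ∏ j, A (β j) j

/-- The extended permanent of `A`: the permanent of the block matrix `[I A]`. -/
def perExt (A : Matrix m n ℝ) : ℝ :=
  per (Matrix.fromCols (1 : Matrix m m ℝ) A)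

/-- `E(l)`, the extended permanent of `γ Ω diag(l)`. -/
def E (γ : ℝ) (Ω : Matrix m n ℝ) (l : n → ℝ) : ℝ :=
  perExt ((γ • Ω) * Matrix.diagonal l)

/-- The bound `log E(l)`. -/
def bound (γ : ℝ) (Ω : Matrix m n ℝ) (l : n → ℝ) : ℝ :=
  Real.log (E γ Ω l)

/-- The vector `l` with its `i`-th entry deleted. -/
def del (l : n → ℝ) (i : n) : {k : n // k ≠ i} → ℝ :=
  fun k => l k.1

/-- `p`: the extended permanent of `γ Ω' diag(v)`, where `Ω'` is `Ω` without its `i`-th column. -/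
def p (γ : ℝ) (Ω : Matrix m n ℝ) (i : n) (v : {k : n // k ≠ i} → ℝ) : ℝ :=
  perExt ((γ • Ω.submatrix id (Subtype.val : {k : n // k ≠ i} → n)) * Matrix.diagonal v)

/-- `q`: the sum over the rows `j` of `γ Ω j i` times the extended permanent of `γ Ω'' diag(v)`,
where `Ω''` is `Ω` without its `j`-th row and its `i`-th column. -/
def q (γ : ℝ) (Ω : Matrix m n ℝ) (i : n) (v : {k : n // k ≠ i} → ℝ) : ℝ :=
  ∑ j : m, γ * Ω j i *
    perExt ((γ • Ω.submatrix (Subtype.val : {r : m // r ≠ j} → m)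
      (Subtype.val : {k : n // k ≠ i} → n)) * Matrix.diagonal v)

/-- The water-filling value `(ν - a / b)⁺`; for `b = 0` the quotient `a / b` (with `a > 0`) is read
as `+∞`, so that the value is `0`. -/
def waterFill (ν a b : ℝ) : ℝ :=
  if b = 0 then 0 else max 0 (ν - a / b)

/-- The power allocations: nonnegative vectors with total power `P`. -/
def feasible (n : Type*) [Fintype n] (P : ℝ) : Set (n → ℝ) :=
  {l | (∀ i, 0 ≤ l i) ∧ ∑ i, l i = P}

end PowerAllocation

end

/-! A row `j` contributes to a nonzero term of Per([I A]) either through its own diagonal 1 or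
through a column, so the extended permanent sums the weights of all matchings of a bipartite graph
with edge weights A. Expanding at a column vertex gives E = p + λ_i q.

Concavity is a Heilmann–Lieb argument. If the edge weights are w_jk x_j y_k with w ≥ 0 and all x_j,
y_k in the open right half-plane, the matching sum is nonzero (`extPer_mask_ne_zero`). Hence E
restricted to a segment is a real polynomial with only real zeros
(`im_eq_zero_of_aeval_segmentPoly`). It is positive on the segment, and its logarithm is a sum of
concave functions log|t - r| and a constant.

Since ∂E/∂λ_i = q, the water-filling equations are the KKT conditions: ν q ≤ E, with equality where
λ_i > 0. They are necessary by moving power between two coordinates, and sufficient by concavity. -/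

noncomputable section

namespace PowerAllocation

/-! ### Matching sums: expansions and vertex deletion. -/

section ExtendedPermanent

variable {m n R : Type*} [Fintype m] [Fintype n] [DecidableEq m] [CommRing R]

/-- The extended permanent over an arbitrary commutative ring. -/
def extPer (A : Matrix m n R) : R :=
  ∑ α : m ↪ m ⊕ n, ∏ j, Matrix.fromCols (1 : Matrix m m R) A j (α j)

theorem perExt_eq_extPer (A : Matrix m n ℝ) : perExt A = extPer A := by
  unfold perExt per extPer
  -- `[I A]` never has more rows than columns.
  rw [if_pos (by simp)]

/-- Used to evaluate the polynomial along a segment at real and complex points. -/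
theorem map_extPer {R' : Type*} [CommRing R'] (φ : R →+* R') (A : Matrix m n R) :
    φ (extPer A) = extPer (A.map φ) := by
  unfold extPer
  rw [map_sum]
  refine Finset.sum_congr rfl fun α _ => ?_
  rw [map_prod]
  refine Finset.prod_congr rfl fun j _ => ?_
  rcases α j with k | k
  · by_cases h : j = k <;> simp [h]
  · simp

/-- The empty matching, given by the embedding `Sum.inl`, already contributes 1. -/
theorem one_le_extPer {A : Matrix m n ℝ} (hA : ∀ j k, 0 ≤ A j k) : 1 ≤ extPer A := by
  have h0 : ∀ j x, 0 ≤ Matrix.fromCols (1 : Matrix m m ℝ) A j x := by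
    rintro j (k | k)
    · by_cases h : j = k <;> simp [h]
    · simp [hA]
  unfold extPer
  refine le_trans ?_ (Finset.single_le_sum (fun α _ => Finset.prod_nonneg fun j _ => h0 j (α j))
    (Finset.mem_univ (Function.Embedding.inl : m ↪ m ⊕ n)))
  simp

variable [DecidableEq n]

/-- Composing with the swap of `inl j` and `inr k` makes the matched row `j` unmatched. Zeros in row
`j` and column `k` of `B` kill all other terms. -/
theorem sum_embedding_apply_eq_inr (A B : Matrix m n R) (j : m) (k : n)
    (hB : ∀ r s, B r s = if r = j ∨ s = k then 0 else A r s) :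
    (∑ α : m ↪ m ⊕ n, if α j = Sum.inr k then
      ∏ r, Matrix.fromCols (1 : Matrix m m R) A r (α r) else 0) = A j k * extPer B := by
  unfold extPer
  conv_rhs => rw [← Equiv.sum_comp (Equiv.embeddingCongr (Equiv.refl m)
    (Equiv.swap (Sum.inl j : m ⊕ n) (Sum.inr k))), Finset.mul_sum]
  refine Finset.sum_congr rfl fun α _ => ?_
  have happ : ∀ r, (Equiv.embeddingCongr (Equiv.refl m)
      (Equiv.swap (Sum.inl j : m ⊕ n) (Sum.inr k)) α) r =
      Equiv.swap (Sum.inl j : m ⊕ n) (Sum.inr k) (α r) := fun r => rfl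
  simp only [happ]
  split_ifs with h
  · rw [← Finset.mul_prod_erase _ _ (Finset.mem_univ j),
      ← Finset.mul_prod_erase _ (fun r => Matrix.fromCols (1 : Matrix m m R) B r _)
        (Finset.mem_univ j), h, Equiv.swap_apply_right]
    simp only [Matrix.fromCols_apply_inr, Matrix.fromCols_apply_inl, Matrix.one_apply_eq, one_mul]
    congr 1
    refine Finset.prod_congr rfl fun r hr => ?_
    have hrj : r ≠ j := Finset.ne_of_mem_erase hr
    have hk : α r ≠ Sum.inr k := fun h' => hrj (α.injective (h'.trans h.symm))
    rcases hr' : α r with l | s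
    · by_cases hl : l = j
      · subst hl
        simp [hB, Matrix.one_apply_ne hrj]
      · rw [Equiv.swap_apply_of_ne_of_ne (by simpa using hl) (by simp)]
        simp
    · have hs : s ≠ k := fun h' => hk (by rw [hr', h'])
      rw [Equiv.swap_apply_of_ne_of_ne (by simp) (by simpa using hs)]
      simp [hB, hrj, hs]
  · rw [Finset.prod_eq_zero (Finset.mem_univ j), mul_zero]
    rcases hr' : α j with l | s
    · by_cases hl : l = j
      · subst hl
        simp [hB]
      · rw [Equiv.swap_apply_of_ne_of_ne (by simpa using hl) (by simp)]
        simp [Matrix.one_apply_ne (Ne.symm hl)]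
    · have hs : s ≠ k := fun h' => h (by rw [hr', h'])
      rw [Equiv.swap_apply_of_ne_of_ne (by simp) (by simpa using hs)]
      simp [hB]

/-- Expansion of the extended permanent along a row. -/
theorem extPer_row_expansion (A : Matrix m n R) (j : m) (A₀ : Matrix m n R)
    (B : n → Matrix m n R) (hA₀ : ∀ r s, A₀ r s = if r = j then 0 else A r s)
    (hB : ∀ k r s, B k r s = if r = j ∨ s = k then 0 else A r s) :
    extPer A = extPer A₀ + ∑ k, A j k * extPer (B k) := by
  simp_rw [← sum_embedding_apply_eq_inr A (B _) j _ (hB _)]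
  rw [Finset.sum_comm]
  unfold extPer
  rw [← Finset.sum_add_distrib]
  refine Finset.sum_congr rfl fun α _ => ?_
  rcases hj : α j with l | s
  · simp only [reduceCtorEq, if_false, Finset.sum_const_zero, add_zero]
    refine Finset.prod_congr rfl fun r _ => ?_
    by_cases hr : r = j
    · subst hr
      simp [hj]
    · rcases α r with _ | _ <;> simp [hA₀, hr]
  · rw [Finset.prod_eq_zero (f := fun r => Matrix.fromCols (1 : Matrix m m R) A₀ r (α r))
      (Finset.mem_univ j) (by simp [hj, hA₀])]
    simp

/-- Expansion of the extended permanent along a column. -/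
theorem extPer_col_expansion (A : Matrix m n R) (k : n) (A₀ : Matrix m n R)
    (B : m → Matrix m n R) (hA₀ : ∀ r s, A₀ r s = if s = k then 0 else A r s)
    (hB : ∀ j r s, B j r s = if r = j ∨ s = k then 0 else A r s) :
    extPer A = extPer A₀ + ∑ j, A j k * extPer (B j) := by
  simp_rw [← sum_embedding_apply_eq_inr A (B _) _ k (hB _)]
  rw [Finset.sum_comm]
  unfold extPer
  rw [← Finset.sum_add_distrib]
  refine Finset.sum_congr rfl fun α _ => ?_
  by_cases h : ∃ j, α j = Sum.inr k
  · obtain ⟨j, hj⟩ := h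
    rw [Finset.prod_eq_zero (f := fun r => Matrix.fromCols (1 : Matrix m m R) A₀ r (α r))
      (Finset.mem_univ j) (by simp [hj, hA₀]), zero_add,
      Finset.sum_eq_single j, if_pos hj]
    · intro r _ hr
      rw [if_neg fun h' => hr (α.injective (h'.trans hj.symm))]
    · simp
  · push Not at h
    simp only [h, if_false, Finset.sum_const_zero, add_zero]
    refine Finset.prod_congr rfl fun r _ => ?_
    rcases hr : α r with _ | s
    · simp
    · have hs : s ≠ k := fun h' => h r (by rw [hr, h'])
      simp [hA₀, hs]

/-- Rows and columns of zeros may be deleted from an extended permanent. -/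
theorem extPer_submatrix_of_eq_zero {m' n' : Type*} [Fintype m'] [Fintype n'] [DecidableEq m']
    [DecidableEq n'] (B : Matrix m n R) {e : m' → m} {g : n' → n}
    (he : Function.Injective e) (hg : Function.Injective g)
    (hrow : ∀ r, r ∉ Set.range e → ∀ s, B r s = 0)
    (hcol : ∀ s, s ∉ Set.range g → ∀ r, B r s = 0) :
    extPer (B.submatrix e g) = extPer B := by
  -- An embedding of the small index set is extended by leaving every row outside the range of `e`
  -- unmatched.
  have hinj : ∀ α : m' ↪ m' ⊕ n',
      Function.Injective (Function.extend e (Sum.map e g ∘ α) (Sum.inl : m → m ⊕ n)) := by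
    intro α r₁ r₂ h
    by_cases h₁ : r₁ ∈ Set.range e <;> by_cases h₂ : r₂ ∈ Set.range e
    · obtain ⟨a, rfl⟩ := h₁
      obtain ⟨b, rfl⟩ := h₂
      rw [he.extend_apply, he.extend_apply] at h
      rw [α.injective (Sum.map_injective.2 ⟨he, hg⟩ h)]
    · obtain ⟨a, rfl⟩ := h₁
      rw [he.extend_apply, Function.extend_apply' _ _ _ h₂] at h
      rcases ha : α a with l | l <;> simp [ha] at h
      exact absurd ⟨l, h⟩ h₂
    · obtain ⟨b, rfl⟩ := h₂
      rw [he.extend_apply, Function.extend_apply' _ _ _ h₁] at h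
      rcases ha : α b with l | l <;> simp [ha] at h
      exact absurd ⟨l, h.symm⟩ h₁
    · rw [Function.extend_apply' _ _ _ h₁, Function.extend_apply' _ _ _ h₂] at h
      exact Sum.inl_injective h
  unfold extPer
  refine Finset.sum_of_injOn (fun α => ⟨_, hinj α⟩) ?_ ?_ ?_ ?_
  · intro α _ β _ h
    ext1 r
    have := congrArg (fun f : m ↪ m ⊕ n => f (e r)) h
    simp only [Function.Embedding.coeFn_mk, he.extend_apply] at this
    exact Sum.map_injective.2 ⟨he, hg⟩ this
  · simp [Set.MapsTo]
  -- A nonzero term leaves deleted rows unmatched and avoids deleted columns, so it comes from an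
  -- extension.
  · intro α _ hα
    by_contra hne
    have hfac : ∀ r, Matrix.fromCols (1 : Matrix m m R) B r (α r) ≠ 0 := fun r h0 =>
      hne (Finset.prod_eq_zero (Finset.mem_univ r) h0)
    have hout : ∀ r, r ∉ Set.range e → α r = Sum.inl r := by
      intro r hr
      have := hfac r
      rcases h : α r with l | s
      · rw [h] at this
        by_contra hl
        exact this (by simpa using Matrix.one_apply_ne (fun h' => hl (by rw [h'])))
      · exact absurd (by simp [h, hrow r hr]) this
    have hin : ∀ r', ∃ x, Sum.map e g x = α (e r') := by
      intro r'
      have := hfac (e r')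
      rcases h : α (e r') with l | s
      · refine ⟨Sum.inl r', ?_⟩
        by_contra hl
        refine this ?_
        rw [h]
        simpa using Matrix.one_apply_ne (fun h' => hl (by simp [h']))
      · by_cases hs : s ∈ Set.range g
        · obtain ⟨s', rfl⟩ := hs
          exact ⟨Sum.inr s', rfl⟩
        · exact absurd (by simp [h, hcol s hs]) this
    choose β hβ using hin
    have hβi : Function.Injective β := fun a b h =>
      he (α.injective (by rw [← hβ, ← hβ, h]))
    refine hα ⟨⟨β, hβi⟩, by simp, ?_⟩
    ext1 r
    by_cases hr : r ∈ Set.range e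
    · obtain ⟨r', rfl⟩ := hr
      simp [he.extend_apply, hβ]
    · simp [Function.extend_apply' _ _ _ hr, hout r hr]
  · intro α _
    refine Fintype.prod_of_injective e he _ _ ?_ ?_
    · intro r hr
      simp [Function.extend_apply' _ _ _ hr]
    · intro r
      simp only [Function.Embedding.coeFn_mk, he.extend_apply, Function.comp_apply]
      rcases α r with l | s
      · simp [Matrix.one_apply, he.eq_iff]
      · simp

/-- The matrix `A` with the rows outside `S` and the columns outside `T` replaced by zero. -/
def mask (A : Matrix m n R) (S : Finset m) (T : Finset n) : Matrix m n R :=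
  Matrix.of fun j k => if j ∈ S ∧ k ∈ T then A j k else 0

theorem extPer_zero : extPer (0 : Matrix m n R) = 1 := by
  have := extPer_submatrix_of_eq_zero (m' := Empty) (n' := Empty) (0 : Matrix m n R)
    (e := Empty.elim) (g := Empty.elim) (fun a => a.elim) (fun a => a.elim)
    (fun _ _ _ => rfl) (fun _ _ _ => rfl)
  rw [← this]
  simp [extPer]

theorem extPer_mask_empty (A : Matrix m n R) (T : Finset n) : extPer (mask A ∅ T) = 1 := by
  have h : mask A ∅ T = 0 := by
    ext
    simp [mask]
  rw [h, extPer_zero]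

theorem extPer_mask_univ (A : Matrix m n R) :
    extPer (mask A Finset.univ Finset.univ) = extPer A := by
  congr 1
  ext
  simp [mask]

/-- Deleting vertices by shrinking `S` and `T` keeps the index types fixed, which suits induction on
the number of vertices. -/
theorem extPer_mask_row (A : Matrix m n R) {S : Finset m} (T : Finset n) {j : m} (hj : j ∈ S) :
    extPer (mask A S T) = extPer (mask A (S.erase j) T) +
      ∑ k ∈ T, A j k * extPer (mask A (S.erase j) (T.erase k)) := by
  rw [extPer_row_expansion (mask A S T) j (mask A (S.erase j) T)
    (fun k => mask A (S.erase j) (T.erase k))]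
  · congr 1
    rw [← Finset.sum_subset (Finset.subset_univ T)]
    · exact Finset.sum_congr rfl fun k hk => by simp [mask, hj, hk]
    · intro k _ hk
      simp [mask, hk]
  · intro r s
    by_cases h : r = j <;> simp [mask, h]
  · intro k r s
    by_cases h : r = j <;> by_cases h' : s = k <;> simp [mask, h, h']

theorem extPer_mask_col (A : Matrix m n R) (S : Finset m) {T : Finset n} {k : n} (hk : k ∈ T) :
    extPer (mask A S T) = extPer (mask A S (T.erase k)) +
      ∑ j ∈ S, A j k * extPer (mask A (S.erase j) (T.erase k)) := by
  rw [extPer_col_expansion (mask A S T) k (mask A S (T.erase k))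
    (fun j => mask A (S.erase j) (T.erase k))]
  · congr 1
    rw [← Finset.sum_subset (Finset.subset_univ S)]
    · exact Finset.sum_congr rfl fun j hj => by simp [mask, hj, hk]
    · intro j _ hj
      simp [mask, hj]
  · intro r s
    by_cases h : s = k <;> simp [mask, h]
  · intro j r s
    by_cases h : r = j <;> by_cases h' : s = k <;> simp [mask, h, h']

end ExtendedPermanent

/-! ### The decomposition of E into p and q, and signs. -/

section Expansion

variable {m n : Type*} [Fintype m] [Fintype n] [DecidableEq m] [DecidableEq n]

theorem E_eq_extPer (γ : ℝ) (Ω : Matrix m n ℝ) (l : n → ℝ) :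
    E γ Ω l = extPer (Matrix.of fun j k => γ * Ω j k * l k) := by
  rw [E, perExt_eq_extPer]
  congr 1
  ext
  simp

theorem p_del_eq_extPer (γ : ℝ) (Ω : Matrix m n ℝ) (l : n → ℝ) (i : n) :
    p γ Ω i (del l i) =
      extPer (Matrix.of fun j k => if k = i then 0 else γ * Ω j k * l k) := by
  rw [p, perExt_eq_extPer, ← extPer_submatrix_of_eq_zero (Matrix.of fun j k => _)
    Function.injective_id (Subtype.val_injective (p := fun k => k ≠ i))]
  · congr 1
    ext j k
    simp [del, k.2]
  · simp
  · intro s hs r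
    have : s = i := by simpa using hs
    simp [this]

theorem q_del_eq_sum_extPer (γ : ℝ) (Ω : Matrix m n ℝ) (l : n → ℝ) (i : n) :
    q γ Ω i (del l i) = ∑ j, γ * Ω j i *
      extPer (Matrix.of fun r k => if r = j ∨ k = i then 0 else γ * Ω r k * l k) := by
  unfold q
  refine Finset.sum_congr rfl fun j _ => ?_
  rw [perExt_eq_extPer, ← extPer_submatrix_of_eq_zero (Matrix.of fun r k => _)
    (Subtype.val_injective (p := fun r => r ≠ j)) (Subtype.val_injective (p := fun k => k ≠ i))]
  · congr 2
    ext r k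
    simp [del, k.2, r.2]
  · intro r hr s
    have : r = j := by simpa using hr
    simp [this]
  · intro s hs r
    have : s = i := by simpa using hs
    simp [this]

theorem E_eq_p_add_mul_q (γ : ℝ) (Ω : Matrix m n ℝ) (l : n → ℝ) (i : n) :
    E γ Ω l = p γ Ω i (del l i) + l i * q γ Ω i (del l i) := by
  rw [E_eq_extPer, p_del_eq_extPer, q_del_eq_sum_extPer, Finset.mul_sum,
    extPer_col_expansion (Matrix.of fun j k => γ * Ω j k * l k) i
      (Matrix.of fun j k => if k = i then 0 else γ * Ω j k * l k)
      (fun j => Matrix.of fun r k => if r = j ∨ k = i then 0 else γ * Ω r k * l k)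
      (fun _ _ => rfl) (fun _ _ _ => rfl)]
  congr 1
  refine Finset.sum_congr rfl fun j _ => ?_
  rw [Matrix.of_apply]
  ring

variable {γ : ℝ} {Ω : Matrix m n ℝ} {l : n → ℝ}

theorem E_pos (hγ : 0 < γ) (hΩ : ∀ j i, 0 ≤ Ω j i) (hl : ∀ i, 0 ≤ l i) : 0 < E γ Ω l := by
  rw [E_eq_extPer]
  exact zero_lt_one.trans_le
    (one_le_extPer fun j k => mul_nonneg (mul_nonneg hγ.le (hΩ j k)) (hl k))

theorem one_le_extPer_deleted (hγ : 0 < γ) (hΩ : ∀ j i, 0 ≤ Ω j i) (hl : ∀ i, 0 ≤ l i)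
    (j : m) (i : n) :
    1 ≤ extPer (Matrix.of fun r k => if r = j ∨ k = i then 0 else γ * Ω r k * l k) := by
  refine one_le_extPer fun r k => ?_
  rw [Matrix.of_apply]
  split_ifs
  · exact le_rfl
  · exact mul_nonneg (mul_nonneg hγ.le (hΩ r k)) (hl k)

theorem q_nonneg (hγ : 0 < γ) (hΩ : ∀ j i, 0 ≤ Ω j i) (hl : ∀ i, 0 ≤ l i) (i : n) :
    0 ≤ q γ Ω i (del l i) := by
  rw [q_del_eq_sum_extPer]
  exact Finset.sum_nonneg fun j _ => mul_nonneg (mul_nonneg hγ.le (hΩ j i))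
    (zero_le_one.trans (one_le_extPer_deleted hγ hΩ hl j i))

theorem q_pos_of_entry_ne_zero (hγ : 0 < γ) (hΩ : ∀ j i, 0 ≤ Ω j i) (hl : ∀ i, 0 ≤ l i)
    {j : m} {i : n} (h : Ω j i ≠ 0) : 0 < q γ Ω i (del l i) := by
  rw [q_del_eq_sum_extPer]
  refine Finset.sum_pos' (fun j _ => mul_nonneg (mul_nonneg hγ.le (hΩ j i))
    (zero_le_one.trans (one_le_extPer_deleted hγ hΩ hl j i))) ⟨j, Finset.mem_univ j, ?_⟩
  exact mul_pos (mul_pos hγ (lt_of_le_of_ne (hΩ j i) h.symm))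
    (zero_lt_one.trans_le (one_le_extPer_deleted hγ hΩ hl j i))

end Expansion

/-! ### Zero-free regions of the matching sum. -/

section Stability

variable {m n : Type*} [Fintype m] [Fintype n] [DecidableEq m] [DecidableEq n]

theorem inv_re_pos {z : ℂ} (hz : 0 < z.re) : 0 < (z⁻¹).re := by
  rw [Complex.inv_re]
  refine div_pos hz (Complex.normSq_pos.2 ?_)
  rintro rfl
  simp at hz

/-- The open right half-plane is stable under inversion, addition and positive scaling; the term
`x⁻¹` keeps the inequality strict. -/
theorem re_add_sum_inv_pos {ι : Type*} (s : Finset ι) {x : ℂ} (hx : 0 < x.re) {w : ι → ℝ}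
    (hw : ∀ k, 0 ≤ w k) {z : ι → ℂ} (hz : ∀ k ∈ s, 0 < (z k).re) :
    0 < (x⁻¹ + ∑ k ∈ s, (w k : ℂ) * (z k)⁻¹).re := by
  rw [Complex.add_re, Complex.re_sum]
  refine add_pos_of_pos_of_nonneg (inv_re_pos hx) (Finset.sum_nonneg fun k hk => ?_)
  rw [Complex.re_ofReal_mul]
  exact mul_nonneg (hw k) (inv_re_pos (hz k hk)).le

/-- The Heilmann–Lieb argument for bipartite graphs: the weighted matching sum and its quotients
by the sums with one vertex deleted, when all vertex weights lie in the right half-plane. -/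
theorem extPer_mask_ne_zero {w : m → n → ℝ} (hw : ∀ j k, 0 ≤ w j k) {x : m → ℂ} {y : n → ℂ}
    (hx : ∀ j, 0 < (x j).re) (hy : ∀ k, 0 < (y k).re) {A : Matrix m n ℂ}
    (hA : ∀ j k, A j k = w j k * (x j * y k)) (N : ℕ) :
    ∀ (S : Finset m) (T : Finset n), S.card + T.card = N →
      extPer (mask A S T) ≠ 0 ∧
      (∀ j ∈ S, 0 < (extPer (mask A S T) / (x j * extPer (mask A (S.erase j) T))).re) ∧
      (∀ k ∈ T, 0 < (extPer (mask A S T) / (y k * extPer (mask A S (T.erase k)))).re) := by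
  have hx0 : ∀ j, x j ≠ 0 := fun j h => by simpa [h] using hx j
  have hy0 : ∀ k, y k ≠ 0 := fun k h => by simpa [h] using hy k
  induction N with
  | zero =>
    intro S T h
    obtain ⟨hS, hT⟩ : S = ∅ ∧ T = ∅ := by simpa using h
    subst hS hT
    simp [extPer_mask_empty]
  | succ N ih =>
    intro S T h
    have hrow : ∀ j ∈ S,
        0 < (extPer (mask A S T) / (x j * extPer (mask A (S.erase j) T))).re := by
      intro j hj
      obtain ⟨h0, -, hq⟩ := ih (S.erase j) T (by
        have := Finset.card_erase_add_one hj
        omega)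
      -- In the row expansion the factor `x j` cancels, and each summand becomes a weight times the
      -- inverse of a quotient covered by induction.
      have key : extPer (mask A S T) / (x j * extPer (mask A (S.erase j) T)) =
          (x j)⁻¹ + ∑ k ∈ T, (w j k : ℂ) * (extPer (mask A (S.erase j) T) /
            (y k * extPer (mask A (S.erase j) (T.erase k))))⁻¹ := by
        rw [extPer_mask_row A T hj, add_div, Finset.sum_div]
        congr 1
        · have := hx0 j
          field_simp
        · refine Finset.sum_congr rfl fun k _ => ?_
          have := hx0 j
          rw [hA, inv_div]
          field_simp
      rw [key]
      exact re_add_sum_inv_pos T (hx j) (hw j) hq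
    have hcol : ∀ k ∈ T,
        0 < (extPer (mask A S T) / (y k * extPer (mask A S (T.erase k)))).re := by
      intro k hk
      obtain ⟨h0, hq, -⟩ := ih S (T.erase k) (by
        have := Finset.card_erase_add_one hk
        omega)
      have key : extPer (mask A S T) / (y k * extPer (mask A S (T.erase k))) =
          (y k)⁻¹ + ∑ j ∈ S, (w j k : ℂ) * (extPer (mask A S (T.erase k)) /
            (x j * extPer (mask A (S.erase j) (T.erase k))))⁻¹ := by
        rw [extPer_mask_col A S hk, add_div, Finset.sum_div]
        congr 1
        · have := hy0 k
          field_simp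
        · refine Finset.sum_congr rfl fun j _ => ?_
          have := hy0 k
          rw [hA, inv_div]
          field_simp
      rw [key]
      exact re_add_sum_inv_pos S (hy k) (fun j => hw j k) hq
    refine ⟨fun h0 => ?_, hrow, hcol⟩
    rcases S.eq_empty_or_nonempty with rfl | ⟨j, hj⟩
    · simp [extPer_mask_empty] at h0
    · have := hrow j hj
      simp [h0] at this

/-- The extended permanent does not vanish if a rotation moves `1` and all column weights into the
right half-plane. -/
theorem extPer_ne_zero_of_re_pos {w : m → n → ℝ} (hw : ∀ j k, 0 ≤ w j k) {v : n → ℂ} {c : ℂ}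
    (hc : 0 < c.re) (hv : ∀ k, 0 < (c * v k).re) :
    extPer (Matrix.of fun j k => (w j k : ℂ) * v k) ≠ 0 := by
  have hc0 : c ≠ 0 := fun h => by simp [h] at hc
  rw [← extPer_mask_univ]
  -- The rows absorb `c⁻¹`, so the edge weights are unchanged.
  refine (extPer_mask_ne_zero hw (x := fun _ => c⁻¹) (y := fun k => c * v k)
    (fun _ => inv_re_pos hc) hv (fun j k => ?_) _ Finset.univ Finset.univ rfl).1
  rw [Matrix.of_apply, inv_mul_cancel_left₀ hc0]

/-- Dividing (1 - z)a + zb by 1 - z gives a + ζb, where ζ = z/(1 - z) is again in the upper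
half-plane. Multiplication by -i then moves both 1 + ζ and a + ζb into the right half-plane. -/
theorem extPer_segment_ne_zero {w : m → n → ℝ} (hw : ∀ j k, 0 ≤ w j k) (a : n → ℝ) {b : n → ℝ}
    (hb : ∀ k, 0 < b k) {z : ℂ} (hz : 0 < z.im) :
    extPer (Matrix.of fun j k => (w j k : ℂ) * (a k + z * (b k - a k))) ≠ 0 := by
  have h1 : (1 - z) ≠ 0 := fun h => by
    have := congrArg Complex.im h
    simp at this
    exact hz.ne' this
  have him : 0 < (z / (1 - z)).im := by
    have h2 : z / (1 - z) = (1 - z)⁻¹ - 1 := by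
      field_simp
      ring
    rw [h2, Complex.sub_im, Complex.inv_im, Complex.one_im, sub_zero]
    refine div_pos ?_ (Complex.normSq_pos.2 h1)
    simpa using hz
  have hone : -Complex.I / (1 - z) = -Complex.I * (1 + z / (1 - z)) := by
    field_simp
    ring
  refine extPer_ne_zero_of_re_pos hw (c := -Complex.I / (1 - z)) ?_ fun k => ?_
  · rw [hone]
    simpa using him
  · have : -Complex.I / (1 - z) * (a k + z * (b k - a k)) =
        -Complex.I * (a k + z / (1 - z) * b k) := by
      field_simp
      ring
    rw [this]
    simpa using mul_pos him (hb k)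

end Stability

/-! ### Log-concavity from real-rootedness. -/

section LogConcave

open Polynomial

theorem concaveOn_log_sub_const {r : ℝ} (hr : r ∉ Set.Icc (0 : ℝ) 1) :
    ConcaveOn ℝ (Set.Icc 0 1) fun t => Real.log (t - r) := by
  have hlog := strictConcaveOn_log_Ioi.concaveOn
  refine ⟨convex_Icc _ _, fun u hu v hv s t hs ht hst => ?_⟩
  rcases lt_or_ge r 0 with h | h
  · have := hlog.2 (x := u - r) (y := v - r) (by simp; linarith [hu.1]) (by simp; linarith [hv.1])
      hs ht hst
    convert this using 2
    simp only [smul_eq_mul]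
    linear_combination r * hst
  · have h1 : 1 < r := by
      by_contra h1
      exact hr ⟨h, not_lt.1 h1⟩
    have := hlog.2 (x := r - u) (y := r - v) (by simp; linarith [hu.2]) (by simp; linarith [hv.2])
      hs ht hst
    simp only [smul_eq_mul] at this ⊢
    -- `Real.log` depends only on the absolute value, so a zero to the right of the interval is
    -- handled by reflection.
    rw [← Real.log_neg_eq_log (u - r), ← Real.log_neg_eq_log (v - r),
      ← Real.log_neg_eq_log (s * u + t * v - r), neg_sub, neg_sub, neg_sub]
    convert this using 2
    linear_combination (-r) * hst

/-- The logarithm of the absolute value of a polynomial all of whose complex zeros are real is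
concave on an interval without zeros. -/
theorem concaveOn_log_eval_of_real_roots (N : ℕ) : ∀ P : ℝ[X], P.natDegree = N →
    (∀ z : ℂ, aeval z P = 0 → z.im = 0) → (∀ t ∈ Set.Icc (0 : ℝ) 1, P.eval t ≠ 0) →
    ConcaveOn ℝ (Set.Icc 0 1) fun t => Real.log (P.eval t) := by
  induction N with
  | zero =>
    intro P hP _ _
    rw [eq_C_of_natDegree_eq_zero hP]
    simpa using concaveOn_const _ (convex_Icc _ _)
  | succ N ih =>
    intro P hP hroot hne
    -- Some complex zero exists and is real, so a real linear factor splits off.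
    obtain ⟨z, hz⟩ := IsAlgClosed.exists_aeval_eq_zero ℂ P (by
      rw [degree_eq_natDegree (by rintro rfl; simp at hP), hP]
      exact_mod_cast N.succ_ne_zero)
    obtain ⟨r, rfl⟩ : ∃ r : ℝ, z = r := ⟨z.re, Complex.ext rfl (by simpa using hroot z hz)⟩
    have hr : P.IsRoot r := by
      have h : aeval (r : ℂ) P = ((P.eval r : ℝ) : ℂ) := by
        rw [← Complex.coe_algebraMap, aeval_algebraMap_apply, coe_aeval_eq_eval]
      rw [h] at hz
      exact_mod_cast hz
    obtain ⟨Q, rfl⟩ := dvd_iff_isRoot.2 hr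
    have hQ0 : Q ≠ 0 := by
      rintro rfl
      simp at hP
    have hrI : r ∉ Set.Icc (0 : ℝ) 1 := fun h => hne r h hr
    have hQne : ∀ t ∈ Set.Icc (0 : ℝ) 1, Q.eval t ≠ 0 := fun t ht h => hne t ht (by simp [h])
    have hQ := ih Q (by
      rw [natDegree_mul (X_sub_C_ne_zero r) hQ0, natDegree_X_sub_C] at hP
      omega) (fun z hz => hroot z (by simp [hz])) hQne
    refine ((concaveOn_log_sub_const hrI).add hQ).congr fun t ht => ?_
    have ht0 : t - r ≠ 0 := fun h => hrI (by rwa [← sub_eq_zero.1 h])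
    simp only [Pi.add_apply, eval_mul, eval_sub, eval_X, eval_C]
    rw [Real.log_mul ht0 (hQne t ht)]

variable {m n : Type*} [Fintype m] [Fintype n] [DecidableEq m]

/-- The polynomial `t ↦ E (a + t (b - a))`. -/
def segmentPoly (γ : ℝ) (Ω : Matrix m n ℝ) (a b : n → ℝ) : ℝ[X] :=
  extPer (Matrix.of fun j k => C (γ * Ω j k) * (C (a k) + X * C (b k - a k)))

theorem aeval_segmentPoly (γ : ℝ) (Ω : Matrix m n ℝ) (a b : n → ℝ) (z : ℂ) :
    aeval z (segmentPoly γ Ω a b) =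
      extPer (Matrix.of fun j k => ((γ * Ω j k : ℝ) : ℂ) * (a k + z * (b k - a k))) := by
  rw [segmentPoly]
  change ((aeval z : ℝ[X] →ₐ[ℝ] ℂ) : ℝ[X] →+* ℂ) _ = _
  rw [map_extPer]
  congr 1
  ext j k
  simp

variable [DecidableEq n]

theorem eval_segmentPoly (γ : ℝ) (Ω : Matrix m n ℝ) (a b : n → ℝ) (t : ℝ) :
    (segmentPoly γ Ω a b).eval t = E γ Ω (a + t • (b - a)) := by
  rw [segmentPoly, ← coe_evalRingHom, map_extPer, E_eq_extPer]
  congr 1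
  ext j k
  simp

theorem im_eq_zero_of_aeval_segmentPoly {γ : ℝ} (hγ : 0 < γ) {Ω : Matrix m n ℝ}
    (hΩ : ∀ j i, 0 ≤ Ω j i) (a : n → ℝ) {b : n → ℝ} (hb : ∀ k, 0 < b k) (z : ℂ)
    (hz : aeval z (segmentPoly γ Ω a b) = 0) : z.im = 0 := by
  have hw : ∀ j k, 0 ≤ γ * Ω j k := fun j k => mul_nonneg hγ.le (hΩ j k)
  rcases lt_trichotomy z.im 0 with h | h | h
  · have hconj : aeval ((starRingEnd ℂ) z) (segmentPoly γ Ω a b) = 0 := by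
      rw [aeval_conj, hz, map_zero]
    rw [aeval_segmentPoly] at hconj
    exact absurd hconj (extPer_segment_ne_zero hw a hb (by simpa using h))
  · exact h
  · rw [aeval_segmentPoly] at hz
    exact absurd hz (extPer_segment_ne_zero hw a hb h)

theorem differentiable_E (γ : ℝ) (Ω : Matrix m n ℝ) : Differentiable ℝ (E γ Ω) := by
  have : E γ Ω = fun l => extPer (Matrix.of fun j k => γ * Ω j k * l k) :=
    funext fun l => E_eq_extPer γ Ω l
  rw [this]
  unfold extPer
  refine Differentiable.fun_sum fun α _ =>
    (contDiff_prod (n := 1) fun j _ => ?_).differentiable one_ne_zero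
  rcases α j with k | k
  · simp only [Matrix.fromCols_apply_inl]
    fun_prop
  · simp only [Matrix.fromCols_apply_inr, Matrix.of_apply]
    fun_prop

variable {γ : ℝ} {Ω : Matrix m n ℝ}

theorem bound_segment_of_pos (hγ : 0 < γ) (hΩ : ∀ j i, 0 ≤ Ω j i) {a b : n → ℝ}
    (ha : ∀ i, 0 ≤ a i) (hb : ∀ i, 0 < b i) {s t : ℝ} (hs : 0 ≤ s) (ht : 0 ≤ t)
    (hst : s + t = 1) :
    s * bound γ Ω a + t * bound γ Ω b ≤ bound γ Ω (s • a + t • b) := by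
  have hcon := concaveOn_log_eval_of_real_roots _ (segmentPoly γ Ω a b) rfl
    (im_eq_zero_of_aeval_segmentPoly hγ hΩ a hb) (fun u hu => by
      rw [eval_segmentPoly]
      refine (E_pos hγ hΩ fun i => ?_).ne'
      have h : (a + u • (b - a)) i = (1 - u) * a i + u * b i := by
        simp
        ring
      rw [h]
      exact add_nonneg (mul_nonneg (by linarith [hu.2]) (ha i)) (mul_nonneg hu.1 (hb i).le))
  have := hcon.2 (x := 0) (y := 1) (by simp) (by simp) hs ht hst
  simp only [eval_segmentPoly, smul_eq_mul, mul_zero, mul_one, zero_add, zero_smul, add_zero,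
    one_smul, add_sub_cancel] at this
  have h : a + t • (b - a) = s • a + t • b := by
    rw [← eq_sub_iff_add_eq] at hst
    rw [hst, smul_sub, sub_smul, one_smul]
    abel
  rw [h] at this
  exact this

theorem concaveOn_bound (hγ : 0 < γ) (hΩ : ∀ j i, 0 ≤ Ω j i) :
    ConcaveOn ℝ {l : n → ℝ | ∀ i, 0 ≤ l i} (bound γ Ω) := by
  have hconv : Convex ℝ {l : n → ℝ | ∀ i, 0 ≤ l i} := by
    intro a ha b hb s t hs ht _ i
    exact add_nonneg (mul_nonneg hs (ha i)) (mul_nonneg ht (hb i))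
  refine ⟨hconv, fun a ha b hb s t hs ht hst => ?_⟩
  have hcont : ∀ l : n → ℝ, (∀ i, 0 ≤ l i) → ContinuousAt (bound γ Ω) l := fun l hl =>
    ((differentiable_E γ Ω).continuous.continuousAt).log (E_pos hγ hΩ hl).ne'
  -- Real-rootedness was shown for a strictly positive endpoint; `b` is perturbed by ε and
  -- continuity gives the boundary case.
  have hlim : Filter.Tendsto (fun ε : ℝ => b + fun _ => ε) (nhdsWithin 0 (Set.Ioi 0)) (nhds b) := by
    refine tendsto_nhdsWithin_of_tendsto_nhds ?_
    have : Continuous fun ε : ℝ => b + fun _ => ε := by fun_prop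
    convert this.tendsto 0 using 2
    ext
    simp
  refine le_of_tendsto_of_tendsto
    (tendsto_const_nhds.add (((hcont b hb).tendsto.comp hlim).const_mul t))
    ((hcont _ (hconv ha hb hs ht hst)).tendsto.comp
      (tendsto_const_nhds.add (hlim.const_smul t))) ?_
  filter_upwards [self_mem_nhdsWithin] with ε hε
  exact bound_segment_of_pos hγ hΩ ha (fun i => add_pos_of_nonneg_of_pos (hb i) hε) hs ht hst

end LogConcave

/-! ### Optimality conditions. -/

section WaterFilling

variable {m n : Type*} [Fintype m] [Fintype n] [DecidableEq m] [DecidableEq n]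

/-- E is affine in the `i`-th coordinate, with slope q independent of that coordinate. -/
theorem fderiv_E_single (γ : ℝ) (Ω : Matrix m n ℝ) (l : n → ℝ) (i : n) :
    fderiv ℝ (E γ Ω) l (Pi.single i 1) = q γ Ω i (del l i) := by
  have h₁ : HasDerivAt (fun t => E γ Ω (Function.update l i t))
      (fderiv ℝ (E γ Ω) l (Pi.single i 1)) (l i) := by
    have hE : HasFDerivAt (E γ Ω) (fderiv ℝ (E γ Ω) l) (Function.update l i (l i)) := by
      rw [Function.update_eq_self]
      exact (differentiable_E γ Ω l).hasFDerivAt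
    exact hE.comp_hasDerivAt (l i) (hasDerivAt_update l i (l i))
  have h₂ : HasDerivAt (fun t => p γ Ω i (del l i) + t * q γ Ω i (del l i))
      (q γ Ω i (del l i)) (l i) := by
    simpa using ((hasDerivAt_id (l i)).mul_const (q γ Ω i (del l i))).const_add
      (p γ Ω i (del l i))
  have h : (fun t => E γ Ω (Function.update l i t)) =
      fun t => p γ Ω i (del l i) + t * q γ Ω i (del l i) := by
    funext t
    have hdel : del (Function.update l i t) i = del l i := by
      funext k
      simp [del, k.2]
    rw [E_eq_p_add_mul_q γ Ω _ i, hdel, Function.update_self]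
  rw [h] at h₁
  exact h₁.unique h₂

theorem fderiv_E_apply (γ : ℝ) (Ω : Matrix m n ℝ) (l v : n → ℝ) :
    fderiv ℝ (E γ Ω) l v = ∑ i, v i * q γ Ω i (del l i) := by
  have := LinearMap.pi_apply_eq_sum_univ (fderiv ℝ (E γ Ω) l : (n → ℝ) →ₗ[ℝ] ℝ) v
  simp only [ContinuousLinearMap.coe_coe, smul_eq_mul] at this
  rw [this]
  refine Finset.sum_congr rfl fun i _ => ?_
  rw [← fderiv_E_single]
  congr 2
  funext k
  simp [Pi.single_apply, eq_comm]

variable {γ : ℝ} {Ω : Matrix m n ℝ} {l : n → ℝ}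

theorem hasFDerivAt_bound (hγ : 0 < γ) (hΩ : ∀ j i, 0 ≤ Ω j i) (hl : ∀ i, 0 ≤ l i) :
    HasFDerivAt (bound γ Ω) ((E γ Ω l)⁻¹ • fderiv ℝ (E γ Ω) l) l :=
  (differentiable_E γ Ω l).hasFDerivAt.log (E_pos hγ hΩ hl).ne'

/-- A concave function lies below its tangent, here along the line from `l` to `u`. -/
theorem bound_sub_le (hγ : 0 < γ) (hΩ : ∀ j i, 0 ≤ Ω j i) (hl : ∀ i, 0 ≤ l i) {u : n → ℝ}
    (hu : ∀ i, 0 ≤ u i) :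
    bound γ Ω u - bound γ Ω l ≤ (E γ Ω l)⁻¹ * ∑ i, (u i - l i) * q γ Ω i (del l i) := by
  have hcon := concaveOn_bound hγ hΩ
  have hline : ConcaveOn ℝ (AffineMap.lineMap l u ⁻¹' {l : n → ℝ | ∀ i, 0 ≤ l i})
      (bound γ Ω ∘ AffineMap.lineMap (k := ℝ) l u) := hcon.comp_affineMap _
  have hd : HasDerivAt (bound γ Ω ∘ AffineMap.lineMap (k := ℝ) l u)
      (((E γ Ω l)⁻¹ • fderiv ℝ (E γ Ω) l) (u - l)) 0 := by
    refine HasFDerivAt.comp_hasDerivAt (0 : ℝ) ?_ AffineMap.hasDerivAt_lineMap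
    rw [AffineMap.lineMap_apply_zero]
    exact hasFDerivAt_bound hγ hΩ hl
  have h := hline.slope_le_of_hasDerivAt (x := 0) (y := 1) (by simpa using hl) (by simpa using hu)
    one_pos hd
  simpa [slope_def_field, fderiv_E_apply] using h

/-- At a maximizer, the partial derivative in a direction with positive power is maximal. -/
theorem q_le_of_isMaxOn (hγ : 0 < γ) (hΩ : ∀ j i, 0 ≤ Ω j i) {P : ℝ} (hl : l ∈ feasible n P)
    (hmax : IsMaxOn (bound γ Ω) (feasible n P) l) {i k : n} (hi : 0 < l i) :
    q γ Ω k (del l k) ≤ q γ Ω i (del l i) := by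
  by_cases hik : k = i
  · rw [hik]
  -- Moving the power of `i` to `k` stays feasible, so the derivative in that direction is
  -- nonpositive.
  have hseg : segment ℝ l (l + l i • (Pi.single k 1 - Pi.single i 1)) ⊆ feasible n P := by
    have hconv : Convex ℝ (feasible n P) := by
      intro a ha b hb s t hs ht hst
      refine ⟨fun r => add_nonneg (mul_nonneg hs (ha.1 r)) (mul_nonneg ht (hb.1 r)), ?_⟩
      simp only [Pi.add_apply, Pi.smul_apply, smul_eq_mul, Finset.sum_add_distrib,
        ← Finset.mul_sum, ha.2, hb.2]
      rw [← add_mul, hst, one_mul]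
    refine hconv.segment_subset hl ⟨fun r => ?_, ?_⟩
    · have := hl.1 r
      by_cases hr : r = i
      · subst hr
        simp [Pi.single_eq_of_ne (Ne.symm hik)]
      · by_cases hk : r = k
        · subst hk
          simpa [Pi.single_eq_of_ne hr] using add_nonneg this hi.le
        · simpa [Pi.single_eq_of_ne hr, Pi.single_eq_of_ne hk] using this
    · simp [Finset.sum_add_distrib, ← Finset.mul_sum, hl.2]
  have h := hmax.localize.hasFDerivWithinAt_nonpos
    (hasFDerivAt_bound hγ hΩ hl.1).hasFDerivWithinAt (mem_posTangentConeAt_of_segment_subset hseg)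
  rw [map_smul, map_sub, smul_eq_mul] at h
  simp only [smul_apply, smul_eq_mul, fderiv_E_single] at h
  rw [← mul_sub] at h
  have hE := inv_pos.2 (E_pos hγ hΩ hl.1)
  exact sub_nonpos.1 (nonpos_of_mul_nonpos_right (nonpos_of_mul_nonpos_right h hi) hE)

theorem exists_waterFill_of_isMaxOn (hγ : 0 < γ) (hΩ : ∀ j i, 0 ≤ Ω j i) (hΩ0 : Ω ≠ 0) {P : ℝ}
    (hP : 0 < P) (hl : l ∈ feasible n P) (hmax : IsMaxOn (bound γ Ω) (feasible n P) l) :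
    ∃ ν : ℝ, ∀ i, l i = waterFill ν (p γ Ω i (del l i)) (q γ Ω i (del l i)) := by
  obtain ⟨i₀, -, hi₀⟩ : ∃ i ∈ Finset.univ, 0 < l i :=
    Finset.exists_lt_of_sum_lt (by simpa [hl.2] using hP)
  -- A nonzero entry of Ω makes some q positive, and the q of an active coordinate is maximal.
  have hq₀ : 0 < q γ Ω i₀ (del l i₀) := by
    obtain ⟨j, k, hjk⟩ : ∃ j k, Ω j k ≠ 0 := by
      by_contra! h
      exact hΩ0 (Matrix.ext h)
    exact (q_pos_of_entry_ne_zero hγ hΩ hl.1 hjk).trans_le (q_le_of_isMaxOn hγ hΩ hl hmax hi₀)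
  -- This level makes ν q = p + l_i q at each active coordinate, since all of these share the
  -- maximal q.
  refine ⟨E γ Ω l / q γ Ω i₀ (del l i₀), fun i => ?_⟩
  have hle := q_le_of_isMaxOn hγ hΩ hl hmax (k := i) hi₀
  have hE := E_pos hγ hΩ hl.1
  unfold waterFill
  rcases (hl.1 i).eq_or_lt with hi | hi
  -- At an inactive coordinate E = p, so p/q is at least ν.
  · split_ifs with h0
    · exact hi.symm
    · have hq : 0 < q γ Ω i (del l i) := lt_of_le_of_ne (q_nonneg hγ hΩ hl.1 i) (Ne.symm h0)
      have hp : E γ Ω l = p γ Ω i (del l i) := by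
        rw [E_eq_p_add_mul_q γ Ω l i, ← hi, zero_mul, add_zero]
      rw [← hp, max_eq_left, ← hi]
      exact sub_nonpos.2 (div_le_div_of_nonneg_left hE.le hq hle)
  · have hq := le_antisymm hle (q_le_of_isMaxOn hγ hΩ hl hmax (k := i₀) hi)
    rw [← hq] at hq₀ ⊢
    have h : E γ Ω l / q γ Ω i (del l i) - p γ Ω i (del l i) / q γ Ω i (del l i) = l i := by
      rw [E_eq_p_add_mul_q γ Ω l i]
      field_simp
      ring
    rw [if_neg hq₀.ne', h, max_eq_right hi.le]

/-- Water-filling gives ν q ≤ E with equality at active coordinates. Weighting by `u` and `l`, which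
have equal sums, bounds the directional derivative towards `u` by 0, and concavity concludes. -/
theorem isMaxOn_of_waterFill (hγ : 0 < γ) (hΩ : ∀ j i, 0 ≤ Ω j i) {P : ℝ} (hP : 0 < P)
    {ν : ℝ} (hν : ∀ i, l i = waterFill ν (p γ Ω i (del l i)) (q γ Ω i (del l i)))
    (hsum : ∑ i, l i = P) :
    l ∈ feasible n P ∧ IsMaxOn (bound γ Ω) (feasible n P) l := by
  have hl : ∀ i, 0 ≤ l i := fun i => by
    rw [hν i, waterFill]
    split_ifs
    · exact le_rfl
    · exact le_max_left _ _
  have hE := E_pos hγ hΩ hl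
  have hqnn := q_nonneg hγ hΩ hl
  have heq : ∀ i, 0 < l i → ν * q γ Ω i (del l i) = E γ Ω l := by
    intro i hi
    have h := hν i
    unfold waterFill at h
    split_ifs at h with h0
    · exact absurd h hi.ne'
    · rcases max_choice 0 (ν - p γ Ω i (del l i) / q γ Ω i (del l i)) with h' | h'
      · rw [h'] at h
        exact absurd h hi.ne'
      · rw [h'] at h
        rw [E_eq_p_add_mul_q γ Ω l i]
        rw [eq_sub_iff_add_eq] at h
        rw [← h]
        field_simp
        ring
  have hle : ∀ i, ν * q γ Ω i (del l i) ≤ E γ Ω l := by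
    intro i
    rcases (hl i).eq_or_lt with hi | hi
    · have h := hν i
      unfold waterFill at h
      split_ifs at h with h0
      · rw [h0, mul_zero]
        exact hE.le
      · have hq : 0 < q γ Ω i (del l i) := lt_of_le_of_ne (hqnn i) (Ne.symm h0)
        have h1 : ν - p γ Ω i (del l i) / q γ Ω i (del l i) ≤ 0 := by
          rw [hi, h]
          exact le_max_right _ _
        rw [sub_nonpos, le_div_iff₀ hq] at h1
        rw [E_eq_p_add_mul_q γ Ω l i, ← hi, zero_mul, add_zero]
        exact h1
    · exact (heq i hi).le
  obtain ⟨i₀, -, hi₀⟩ : ∃ i ∈ Finset.univ, 0 < l i :=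
    Finset.exists_lt_of_sum_lt (by simpa [hsum] using hP)
  have hνpos : 0 < ν := by
    have h := heq i₀ hi₀
    exact pos_of_mul_pos_left (h ▸ hE) (hqnn i₀)
  refine ⟨⟨hl, hsum⟩, fun u hu => ?_⟩
  have hgrad : ν * ∑ i, (u i - l i) * q γ Ω i (del l i) ≤ 0 := by
    calc ν * ∑ i, (u i - l i) * q γ Ω i (del l i)
        = ∑ i, (u i * (ν * q γ Ω i (del l i)) - l i * (ν * q γ Ω i (del l i))) := by
          rw [Finset.mul_sum]
          exact Finset.sum_congr rfl fun i _ => by ring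
      _ ≤ ∑ i, (u i * E γ Ω l - l i * E γ Ω l) := by
          refine Finset.sum_le_sum fun i _ => sub_le_sub
            (mul_le_mul_of_nonneg_left (hle i) (hu.1 i)) ?_
          rcases (hl i).eq_or_lt with hi | hi
          · simp [← hi]
          · rw [heq i hi]
      _ = 0 := by
          rw [Finset.sum_sub_distrib, ← Finset.sum_mul, ← Finset.sum_mul, hu.2, hsum, sub_self]
  have h := bound_sub_le hγ hΩ hl hu.1
  have h' := mul_nonpos_of_nonneg_of_nonpos (inv_nonneg.2 hE.le)
    (nonpos_of_mul_nonpos_right hgrad hνpos)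
  exact sub_nonpos.1 (h.trans h')

end WaterFilling

end PowerAllocation

end

theorem theorem3 {Nr Nt : ℕ} (γ : ℝ) (hγ : 0 < γ)
    (Ω : Matrix (Fin Nr) (Fin Nt) ℝ) (hΩ : ∀ j i, 0 ≤ Ω j i) (hΩ0 : Ω ≠ 0) :
    ConcaveOn ℝ {l : Fin Nt → ℝ | ∀ i, 0 ≤ l i} (PowerAllocation.bound γ Ω) ∧
    (∀ (l : Fin Nt → ℝ) (i : Fin Nt),
      PowerAllocation.E γ Ω l =
        PowerAllocation.p γ Ω i (PowerAllocation.del l i) +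
          l i * PowerAllocation.q γ Ω i (PowerAllocation.del l i)) ∧
    (∀ l : Fin Nt → ℝ,
      (l ∈ PowerAllocation.feasible (Fin Nt) (Nt : ℝ) ∧
        IsMaxOn (PowerAllocation.bound γ Ω) (PowerAllocation.feasible (Fin Nt) (Nt : ℝ)) l) ↔
      ∃ ν : ℝ,
        (∀ i, l i = PowerAllocation.waterFill ν
          (PowerAllocation.p γ Ω i (PowerAllocation.del l i))
          (PowerAllocation.q γ Ω i (PowerAllocation.del l i))) ∧
        ∑ i, l i = (Nt : ℝ)) := by
  -- A nonzero matrix has a column; positive total power then forces an active coordinate.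
  have hNt : (0 : ℝ) < Nt := by
    rw [Nat.cast_pos, Nat.pos_iff_ne_zero]
    rintro rfl
    exact hΩ0 (Matrix.ext fun _ i => i.elim0)
  refine ⟨PowerAllocation.concaveOn_bound hγ hΩ, PowerAllocation.E_eq_p_add_mul_q γ Ω,
    fun l => ⟨fun ⟨hl, hmax⟩ => ?_, fun ⟨ν, hν, hsum⟩ =>
      PowerAllocation.isMaxOn_of_waterFill hγ hΩ hNt hν hsum⟩⟩
  obtain ⟨ν, hν⟩ := PowerAllocation.exists_waterFill_of_isMaxOn hγ hΩ hΩ0 hNt hl hmax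
  exact ⟨ν, hν, hl.2⟩
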